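/- Let $K \subset S^3$ be a (tame) knot, let $V(K)$ be an open tubular neighbourhood of $K$, let $M_K = S^3 \setminus V(K)$ be its exterior and $\Gamma = \pi_1(M_K)$ its knot group. Let $P = \langle g_1, \ldots, g_k \mid r_1, \ldots, r_{k-1} \rangle$ be a Wirtinger presentation of $\Gamma$, that is, a presentation in which each relator says that some generator is a conjugate of some generator (up to conjugation, each $r_i$ is a word $w g_b w^{-1} g_c^{-1}$). Let $\phi \colon \Gamma \to \mathbb{Z}$ be the homomorphism with $\phi(g_i) = 1$ for all $i$. For $t \in \mathbb{C}^* = \mathbb{C} \setminus \{0\}$ let $\psi_t \colon \mathbb{C}\Gamma \to \mathbb{C}\Gamma$ be the ring homomorphism $\sum_g c_g\, g \mapsto \sum_g c_g\, t^{\phi(g)} g$. Let $F_1 \in M((k-1)\times(k-1); \mathbb{C}\Gamma)$ be the matrix obtained from the Fox matrix $(\partial r_i / \partial g_l)_{i,l}$ by removing its first column, and let $A_t \colon \ell^2(\Gamma)^{k-1} \to \ell^2(\Gamma)^{k-1}$ be right multiplication with the matrix $\psi_t(F_1)$. For a bounded $\Gamma$-equivariant operator $f \colon \ell^2(\Gamma)^m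 \to \ell^2(\Gamma)^n$ let $F(f)(\lambda)$, $\lambda \ge 0$, be the von Neumann dimension of the image of the spectral projection $E_{\lambda^2}$ of $f^*f$, that is, the von Neumann trace of this projection. The Fuglede–Kadison determinant of $f$ is $$\det\nolimits_{\mathcal{N}(\Gamma)}(f) = \exp\Big(\int_{0^+}^\infty \ln(\lambda)\, dF(f)(\lambda)\Big)$$ if the integral is $> -\infty$, and $\det_{\mathcal{N}(\Gamma)}(f) = 0$ otherwise. Put $\Delta^{(2)}_{K,P}(t) := \det_{\mathcal{N}(\Gamma)}(A_t) \in [0,\infty)$. Then for every $t \in \mathbb{C}^*$ $$\Delta^{(2)}_{K,P}(t) = \Delta^{(2)}_{K,P}(|t|).$$ Moreover, $A_t$ is injective with positive Fuglede–Kadison determinant if and only if $A_{|t|}$ is, so that the equality also makes sense, at both parameters simultaneously, when the $L^2$-Alexander invariant is only defined under this hypothesis. -/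

import Mathlib

open scoped ENNReal

noncomputable section

namespace L2Alexander

/-! ### The Hilbert space `ℓ²(G)` and right multiplication -/

/-- `ℓ²(G)`, square-summable complex functions on the discrete group `G`; the inner product is
`⟪c, d⟫ = ∑ conj (c g) * d g`. The element `g` of `G` is the indicator function of `{g}`. -/
abbrev L2 (G : Type*) : Type _ := lp (fun _ : G => ℂ) 2

/-- The orthogonal direct sum `ℓ²(G)ⁿ`. -/
abbrev L2n (G : Type*) (n : ℕ) : Type _ := PiLp 2 (fun _ : Fin n => L2 G)

section L2

variable {G : Type*} [Group G]

/-- Translating the argument of a function in `ℓ²(G)` on the right keeps it in `ℓ²(G)`. -/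
lemma memℓp_translate (g : G) (x : L2 G) : Memℓp (fun h : G => x (h * g⁻¹)) 2 := by
  have h2 : 0 < (2 : ℝ≥0∞).toReal := by norm_num
  refine memℓp_gen ?_
  have := (Equiv.mulRight g⁻¹).summable_iff.mpr ((lp.memℓp x).summable h2)
  simpa [Function.comp_def] using this

/-- Right multiplication by a group element, `∑ c_h · h ↦ ∑ c_h · (h g)`; the value of the image
at `h` is `c_{h g⁻¹}`. -/
def rightMulIsometry (g : G) : L2 G →ₗᵢ[ℂ] L2 G where
  toFun x := ⟨fun h => x (h * g⁻¹), memℓp_translate g x⟩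
  map_add' x y := by ext h; simp; rfl
  map_smul' c x := by ext h; simp
  norm_map' x := by
    have h2 : 0 < (2 : ℝ≥0∞).toReal := by norm_num
    rw [lp.norm_eq_tsum_rpow h2, lp.norm_eq_tsum_rpow h2]
    congr 1
    exact (Equiv.mulRight g⁻¹).tsum_eq (fun h => ‖x h‖ ^ (2 : ℝ≥0∞).toReal)

/-- Right multiplication by an element `a = ∑ a_g · g` of the complex group ring, as a bounded
operator of `ℓ²(G)`. -/
def rightMul (a : MonoidAlgebra ℂ G) : L2 G →L[ℂ] L2 G :=
  a.coeff.sum fun g c => c • (rightMulIsometry g).toContinuousLinearMap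

/-- Right multiplication by an `m × n` matrix over the complex group ring: the row vector
`(x_i)` is sent to the row vector `(∑ i, x_i · A_{i j})_j`. -/
def rightMulMatrix {m n : ℕ} (A : Matrix (Fin m) (Fin n) (MonoidAlgebra ℂ G)) :
    L2n G m →L[ℂ] L2n G n :=
  (PiLp.continuousLinearEquiv 2 ℂ (fun _ : Fin n => L2 G)).symm.toContinuousLinearMap ∘L
    ContinuousLinearMap.pi fun j : Fin n =>
      ∑ i : Fin m, rightMul (A i j) ∘L PiLp.proj 2 (fun _ : Fin m => L2 G) i

end L2

/-! ### Spectral projections -/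

section Spectral

variable {H : Type*} [NormedAddCommGroup H] [InnerProductSpace ℂ H] [CompleteSpace H]

/-- For a self-adjoint operator `T`, the image of the spectral projection
`E_a = 1_{(-∞, a]}(T)`, given as the kernel of the positive part `(T - a)₊` (continuous functional
calculus). -/
def spectralSubspace (T : H →L[ℂ] H) (a : ℝ) : Submodule ℂ H :=
  (cfc (fun x : ℝ => max (x - a) 0) T).ker

instance (T : H →L[ℂ] H) (a : ℝ) : (spectralSubspace T a).HasOrthogonalProjection :=
  haveI : CompleteSpace (spectralSubspace T a) :=
    (cfc (fun x : ℝ => max (x - a) 0) T).isClosed_ker.completeSpace_coe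
  inferInstance

lemma spectralSubspace_mono {T : H →L[ℂ] H} (_hT : IsSelfAdjoint T) :
    Monotone (spectralSubspace T) := by
  intro a b hab
  rcases hab.eq_or_lt with rfl | hlt
  · exact le_rfl
  intro x hx
  have hd : ∀ y : ℝ, 0 < max (y - a) (b - a) := fun y => lt_max_of_lt_right (sub_pos.2 hlt)
  have hfac : (fun y : ℝ => max (y - b) 0)
      = fun y => (max (y - b) 0 / max (y - a) (b - a)) * max (y - a) 0 := by
    funext y
    rcases le_total y b with h | h
    · simp [max_eq_right (sub_nonpos.2 h)]
    · have h1 : max (y - a) (b - a) = y - a := max_eq_left (by linarith)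
      have h2 : max (y - a) 0 = y - a := max_eq_left (by linarith)
      have h3 : y - a ≠ 0 := by linarith
      rw [h1, h2, div_mul_cancel₀ _ h3]
  have hc : Continuous fun y : ℝ => max (y - b) 0 / max (y - a) (b - a) :=
    Continuous.div (by fun_prop) (by fun_prop) fun y => (hd y).ne'
  have hc' : Continuous fun y : ℝ => max (y - a) 0 := by fun_prop
  have hx' : (cfc (fun y : ℝ => max (y - a) 0) T) x = 0 := hx
  change (cfc (fun y : ℝ => max (y - b) 0) T) x = 0
  rw [hfac, cfc_mul _ _ T hc.continuousOn hc'.continuousOn, mul_apply_eq_comp, hx',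
    map_zero]

lemma iInf_spectralSubspace {T : H →L[ℂ] H} (hT : IsSelfAdjoint T) (a : ℝ) :
    ⨅ b : Set.Ioi a, spectralSubspace T b = spectralSubspace T a := by
  refine le_antisymm (fun x hx => ?_) (le_iInf fun b => spectralSubspace_mono hT (le_of_lt b.2))
  rw [Submodule.mem_iInf] at hx
  change (cfc (fun y : ℝ => max (y - a) 0) T) x = 0
  have key : ∀ ε : ℝ, 0 < ε → ‖(cfc (fun y : ℝ => max (y - a) 0) T) x‖ ≤ ε * ‖x‖ := by
    intro ε hε
    have h0 : (cfc (fun y : ℝ => max (y - (a + ε)) 0) T) x = 0 :=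
      hx ⟨a + ε, lt_add_of_pos_right a hε⟩
    have h1 : (cfc (fun y : ℝ => max (y - a) 0) T) x
        = (cfc (fun y : ℝ => max (y - a) 0 - max (y - (a + ε)) 0) T) x := by
      rw [cfc_sub (fun y : ℝ => max (y - a) 0) (fun y : ℝ => max (y - (a + ε)) 0) T
        (by fun_prop) (by fun_prop), sub_apply, h0, sub_zero]
    rw [h1]
    refine ContinuousLinearMap.le_of_opNorm_le _ (norm_cfc_le hε.le fun y _ => ?_) x
    rw [Real.norm_eq_abs, abs_le]
    rcases max_cases (y - a) 0 with h | h <;> rcases max_cases (y - (a + ε)) 0 with h' | h' <;>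
      constructor <;> linarith [h.1, h.2, h'.1, h'.2]
  have hlim : Filter.Tendsto (fun ε : ℝ => ε * ‖x‖) (nhdsWithin 0 (Set.Ioi 0)) (nhds 0) := by
    have : Filter.Tendsto (fun ε : ℝ => ε * ‖x‖) (nhds 0) (nhds (0 * ‖x‖)) :=
      (continuous_id.mul continuous_const).tendsto 0
    rw [zero_mul] at this
    exact this.mono_left nhdsWithin_le_nhds
  have := ge_of_tendsto hlim (Filter.eventually_of_mem self_mem_nhdsWithin key)
  exact norm_le_zero_iff.1 this

/-- The spectral projections are strongly continuous from the right. -/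
lemma tendsto_starProjection_spectralSubspace {T : H →L[ℂ] H} (hT : IsSelfAdjoint T) (a : ℝ)
    (x : H) :
    Filter.Tendsto (fun b => (spectralSubspace T b).starProjection x) (nhdsWithin a (Set.Ioi a))
      (nhds ((spectralSubspace T a).starProjection x)) := by
  let U : (Set.Ioi a)ᵒᵈ → Submodule ℂ H := fun b =>
    (spectralSubspace T ((OrderDual.ofDual b : Set.Ioi a) : ℝ))ᗮ
  have hU : Monotone U := fun b c hbc =>
    Submodule.orthogonal_le (spectralSubspace_mono hT
      (show ((OrderDual.ofDual c : Set.Ioi a) : ℝ) ≤ (OrderDual.ofDual b : Set.Ioi a) from hbc))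
  have hcl : (⨆ b, U b).topologicalClosure = (spectralSubspace T a)ᗮ := by
    rw [← Submodule.orthogonal_orthogonal_eq_closure, ← Submodule.iInf_orthogonal]
    congr 1
    rw [← iInf_spectralSubspace hT a]
    exact iInf_congr fun b => Submodule.orthogonal_orthogonal
      (spectralSubspace T ((OrderDual.ofDual b : Set.Ioi a) : ℝ))
  have : ∀ b, (U b).HasOrthogonalProjection := fun b =>
    inferInstanceAs (spectralSubspace T ((OrderDual.ofDual b : Set.Ioi a) : ℝ))ᗮ.HasOrthogonalProjection
  have h1 := Submodule.starProjection_tendsto_closure_iSup U hU x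
  simp only [hcl] at h1
  have h2 := (tendsto_const_nhds (x := x)).sub h1
  have e : ∀ b : ℝ, x - (spectralSubspace T b)ᗮ.starProjection x
      = (spectralSubspace T b).starProjection x := fun b => by
    rw [Submodule.starProjection_orthogonal_val, sub_sub_cancel]
  rw [e] at h2
  rw [← tendsto_comp_coe_Ioi_atBot]
  refine Filter.Tendsto.congr (fun b => ?_) h2
  exact e b

lemma isSelfAdjoint_adjoint_comp {H' : Type*} [NormedAddCommGroup H'] [InnerProductSpace ℂ H']
    [CompleteSpace H'] (f : H →L[ℂ] H') : IsSelfAdjoint (f.adjoint ∘L f) := by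
  rw [ContinuousLinearMap.isSelfAdjoint_iff', ContinuousLinearMap.adjoint_comp,
    ContinuousLinearMap.adjoint_adjoint]

end Spectral

/-! ### Von Neumann trace and dimension, spectral density, Fuglede–Kadison determinant -/

section Determinant

variable {G : Type*} [Group G]

open Classical in
/-- The vector of `ℓ²(G)ⁿ` with the unit `e ∈ G` at position `i` and zeros elsewhere. -/
def unitVec (G : Type*) [Group G] {n : ℕ} (i : Fin n) : L2n G n :=
  PiLp.single 2 i (lp.single 2 (1 : G) (1 : ℂ))

/-- The von Neumann trace of an operator of `ℓ²(G)ⁿ`: the sum over the diagonal matrix entries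
`φ i i` of `⟪φ i i e, e⟫`. -/
def vnTrace {n : ℕ} (φ : L2n G n →L[ℂ] L2n G n) : ℂ :=
  ∑ i : Fin n, inner ℂ (φ (unitVec G i)) (unitVec G i)

/-- The von Neumann dimension of a closed (`G`-invariant) subspace of `ℓ²(G)ⁿ`: the trace of the
orthogonal projection onto it, which is a real number. -/
def vnDim {n : ℕ} (S : Submodule ℂ (L2n G n)) [S.HasOrthogonalProjection] : ℝ :=
  (vnTrace S.starProjection).re

lemma vnDim_eq {n : ℕ} (S : Submodule ℂ (L2n G n)) [S.HasOrthogonalProjection] :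
    vnDim S = ∑ i : Fin n, ‖S.starProjection (unitVec G i)‖ ^ 2 := by
  rw [vnDim, vnTrace, Complex.re_sum]
  refine Finset.sum_congr rfl fun i _ => ?_
  have h := Submodule.starProjection_inner_eq_zero (K := S) (unitVec G i)
    (S.starProjection (unitVec G i)) (Submodule.starProjection_apply_mem S _)
  rw [inner_sub_left, sub_eq_zero] at h
  rw [← inner_conj_symm, h, inner_self_eq_norm_sq_to_K]
  norm_cast

lemma vnDim_mono {n : ℕ} {S S' : Submodule ℂ (L2n G n)} [S.HasOrthogonalProjection]
    [S'.HasOrthogonalProjection] (h : S ≤ S') : vnDim S ≤ vnDim S' := by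
  rw [vnDim_eq, vnDim_eq]
  refine Finset.sum_le_sum fun i _ => ?_
  have e : S.starProjection (S'.starProjection (unitVec G i)) = S.starProjection (unitVec G i) :=
    congrArg (fun f : L2n G n →L[ℂ] L2n G n => f (unitVec G i))
      (Submodule.starProjection_comp_starProjection_of_le h)
  rw [← e]
  gcongr
  simpa using S.starProjection.le_of_opNorm_le (Submodule.starProjection_norm_le (K := S))
    (S'.starProjection (unitVec G i))

/-- The spectral density function of a morphism `f : ℓ²(G)ᵐ → ℓ²(G)ⁿ`: its value at `l ≥ 0` is the
von Neumann dimension of the image of the spectral projection `E_{l²}` of `f* f`; it vanishes on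
the negative half-line. -/
def spectralDensity {m n : ℕ} (f : L2n G m →L[ℂ] L2n G n) (l : ℝ) : ℝ :=
  if 0 ≤ l then vnDim (spectralSubspace (f.adjoint ∘L f) (l ^ 2)) else 0

/-- The spectral density function is monotone and right-continuous. -/
def spectralStieltjes {m n : ℕ} (f : L2n G m →L[ℂ] L2n G n) : StieltjesFunction ℝ where
  toFun := spectralDensity f
  mono' := by
    intro a b hab
    unfold spectralDensity
    split_ifs with ha hb hb
    · exact vnDim_mono (spectralSubspace_mono (isSelfAdjoint_adjoint_comp f) (by gcongr))
    · exact absurd (ha.trans hab) hb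
    · rw [vnDim_eq]; positivity
    · exact le_rfl
  right_continuous' := by
    intro a
    rw [← continuousWithinAt_Ioi_iff_Ici]
    rcases lt_or_ge a 0 with ha | ha
    · refine (continuousAt_const (y := (0 : ℝ))).continuousWithinAt.congr_of_eventuallyEq ?_ ?_
      · refine nhdsWithin_le_nhds (Filter.eventually_of_mem (Iio_mem_nhds ha) fun b hb => ?_)
        exact if_neg (not_le.2 hb)
      · exact if_neg (not_le.2 ha)
    · have hsq : Filter.Tendsto (fun b : ℝ => b ^ 2) (nhdsWithin a (Set.Ioi a))
          (nhdsWithin (a ^ 2) (Set.Ioi (a ^ 2))) := by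
        refine tendsto_nhdsWithin_of_tendsto_nhds_of_eventually_within _ ?_ ?_
        · exact ((continuous_pow 2).tendsto a).mono_left nhdsWithin_le_nhds
        · exact Filter.eventually_of_mem self_mem_nhdsWithin fun b (hb : a < b) =>
            pow_lt_pow_left₀ hb ha two_ne_zero
      have hdim : Filter.Tendsto (fun b : ℝ => vnDim (spectralSubspace (f.adjoint ∘L f) (b ^ 2)))
          (nhdsWithin a (Set.Ioi a))
          (nhds (vnDim (spectralSubspace (f.adjoint ∘L f) (a ^ 2)))) := by
        simp only [vnDim_eq]
        refine tendsto_finsetSum _ fun i _ => ?_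
        exact (((tendsto_starProjection_spectralSubspace (isSelfAdjoint_adjoint_comp f) (a ^ 2)
          (unitVec G i)).comp hsq).norm).pow 2
      have e : spectralDensity f a = vnDim (spectralSubspace (f.adjoint ∘L f) (a ^ 2)) := if_pos ha
      rw [ContinuousWithinAt, e]
      refine hdim.congr' (Filter.eventually_of_mem self_mem_nhdsWithin fun b (hb : a < b) => ?_)
      exact (if_pos (ha.trans hb.le)).symm

/-- The measure `dF(f)` with `dF(f)((a, b]) = F(f)(b) - F(f)(a)` for `a < b`. -/
def spectralMeasure {m n : ℕ} (f : L2n G m →L[ℂ] L2n G n) : MeasureTheory.Measure ℝ :=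
  (spectralStieltjes f).measure

open Classical in
/-- The Fuglede–Kadison determinant: `exp (∫_{0+}^∞ log l dF(f)(l))` if the integral is
`> -∞`, and `0` otherwise. Since `F(f)` is bounded and constant on `[‖f‖, ∞)`, the positive part of
`log` is always integrable, so that the integral is `> -∞` exactly when `log` is integrable on
`(0, ∞)`. -/
def fkDet {m n : ℕ} (f : L2n G m →L[ℂ] L2n G n) : ℝ :=
  if MeasureTheory.IntegrableOn Real.log (Set.Ioi 0) (spectralMeasure f) then
    Real.exp (∫ l in Set.Ioi (0 : ℝ), Real.log l ∂(spectralMeasure f))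
  else 0

end Determinant

/-! ### Fox calculus -/

section Fox

variable {α : Type*}

/-- Left multiplication of `FreeGroup α` on the additive group of its integral group ring, written
multiplicatively. -/
def foxAction (α : Type*) :
    FreeGroup α →* MulAut (Multiplicative (MonoidAlgebra ℤ (FreeGroup α))) :=
  (MulAutMultiplicative (MonoidAlgebra ℤ (FreeGroup α))).symm.toMonoidHom.comp
    (AddAut.mulLeft.comp (MonoidAlgebra.of ℤ (FreeGroup α)).toHomUnits)

open Classical in
/-- The homomorphism `w ↦ (∂w/∂x_l, w)` into the semidirect product, in which
`(a, u) (b, v) = (a + u b, u v)`. -/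
def foxHom (l : α) :
    FreeGroup α →* SemidirectProduct (Multiplicative (MonoidAlgebra ℤ (FreeGroup α)))
      (FreeGroup α) (foxAction α) :=
  FreeGroup.lift fun i => ⟨Multiplicative.ofAdd (if i = l then 1 else 0), FreeGroup.of i⟩

/-- The Fox derivative `∂w/∂x_l`, characterised by `fox_of` and `fox_mul` below. -/
def fox (l : α) (w : FreeGroup α) : MonoidAlgebra ℤ (FreeGroup α) :=
  Multiplicative.toAdd (foxHom l w).left

open Classical in
lemma fox_of (l i : α) : fox l (FreeGroup.of i) = if i = l then 1 else 0 := by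
  simp [fox, foxHom]

lemma fox_mul (l : α) (u v : FreeGroup α) :
    fox l (u * v) = fox l u + MonoidAlgebra.of ℤ (FreeGroup α) u * fox l v := by
  have hr : ∀ w : FreeGroup α, (foxHom l w).right = w := by
    intro w
    have : (SemidirectProduct.rightHom.comp (foxHom l)) = MonoidHom.id (FreeGroup α) := by
      ext i; simp [foxHom]
    exact DFunLike.congr_fun this w
  rw [fox, map_mul, SemidirectProduct.mul_left, hr]
  rfl

end Fox

/-! ### Wirtinger presentations and the invariant -/

section Alexander

/-- `r` says that some generator is a conjugate of some generator: up to conjugation it is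
`w x_b w⁻¹ x_c⁻¹`. (The inverse of such a word is conjugate to a word of the same form.) -/
def IsWirtingerRelator {α : Type*} (r : FreeGroup α) : Prop :=
  ∃ (w : FreeGroup α) (b c : α),
    IsConj r (w * FreeGroup.of b * w⁻¹ * (FreeGroup.of c)⁻¹)

/-- A Wirtinger presentation `⟨g_0, …, g_n ∣ r_0, …, r_{n-1}⟩` of `G`: one generator more than
relators, every relator is of Wirtinger type, and `iso` identifies the presented group with `G`.
In terms of the number `k` of generators, `n = k - 1`. -/
structure WirtingerPresentation (G : Type*) [Group G] where
  /-- The number of relators. -/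
  n : ℕ
  /-- The relators. -/
  rel : Fin n → FreeGroup (Fin (n + 1))
  wirtinger : ∀ i, IsWirtingerRelator (rel i)
  /-- The identification of the presented group with `G`. -/
  iso : PresentedGroup (Set.range rel) ≃* G

namespace WirtingerPresentation

variable {G : Type*} [Group G] (P : WirtingerPresentation G)

/-- The projection from the free group on the generators to `G`. -/
def proj : FreeGroup (Fin (P.n + 1)) →* G :=
  P.iso.toMonoidHom.comp (PresentedGroup.mk (Set.range P.rel))

lemma lift_rel (r : FreeGroup (Fin (P.n + 1))) (hr : r ∈ Set.range P.rel) :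
    FreeGroup.lift (fun _ : Fin (P.n + 1) => Multiplicative.ofAdd (1 : ℤ)) r = 1 := by
  obtain ⟨i, rfl⟩ := hr
  obtain ⟨w, b, c, h⟩ := P.wirtinger i
  have h' := (FreeGroup.lift (fun _ : Fin (P.n + 1) => Multiplicative.ofAdd (1 : ℤ))).map_isConj h
  rw [isConj_iff_eq] at h'
  rw [h']
  simp

/-- The homomorphism `φ : G → ℤ` that sends every generator to `1`. -/
def phi : G →* Multiplicative ℤ :=
  (PresentedGroup.toGroup (f := fun _ : Fin (P.n + 1) => Multiplicative.ofAdd (1 : ℤ))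
    P.lift_rel).comp P.iso.symm.toMonoidHom

lemma phi_generator (i : Fin (P.n + 1)) :
    P.phi (P.proj (FreeGroup.of i)) = Multiplicative.ofAdd 1 := by
  have h : PresentedGroup.mk (Set.range P.rel) (FreeGroup.of i) = PresentedGroup.of i := rfl
  simp [phi, proj, h]

/-- The ring homomorphism `ψ_t : ∑ c_g · g ↦ ∑ c_g t^{φ(g)} · g` of the complex group ring. -/
def psi (t : ℂˣ) : MonoidAlgebra ℂ G →ₐ[ℂ] MonoidAlgebra ℂ G :=
  MonoidAlgebra.lift ℂ (MonoidAlgebra ℂ G) G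
    { toFun := fun g => MonoidAlgebra.single g ((t ^ (Multiplicative.toAdd (P.phi g)) : ℂˣ) : ℂ)
      map_one' := by simp [MonoidAlgebra.one_def]
      map_mul' := fun g h => by simp [MonoidAlgebra.single_mul_single, zpow_add] }

lemma psi_single (t : ℂˣ) (g : G) (c : ℂ) :
    P.psi t (MonoidAlgebra.single g c)
      = MonoidAlgebra.single g (c * (t : ℂ) ^ (Multiplicative.toAdd (P.phi g))) := by
  simp [psi]

/-- The Fox matrix `(∂r_i/∂g_l)`, with entries in the complex group ring of `G`. -/
def foxMatrix : Matrix (Fin P.n) (Fin (P.n + 1)) (MonoidAlgebra ℂ G) :=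
  Matrix.of fun i l =>
    MonoidAlgebra.mapDomainRingHom ℂ P.proj
      (MonoidAlgebra.mapRingHom (FreeGroup (Fin (P.n + 1))) (Int.castRingHom ℂ) (fox l (P.rel i)))

/-- The square matrix `F_1`: the Fox matrix without its first column. -/
def foxMinor : Matrix (Fin P.n) (Fin P.n) (MonoidAlgebra ℂ G) :=
  P.foxMatrix.submatrix id Fin.succ

/-- The operator of `ℓ²(G)ⁿ` given by right multiplication with the matrix `ψ_t(F_1)`. -/
def alexanderOperator (t : ℂˣ) : L2n G P.n →L[ℂ] L2n G P.n :=
  rightMulMatrix (P.foxMinor.map (P.psi t))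

/-- The `L²`-Alexander invariant at `t`, with respect to the presentation `P`. -/
def alexanderInvariant (t : ℂˣ) : ℝ := fkDet (P.alexanderOperator t)

/-- The operator at `t` is injective and has positive determinant. -/
def Admissible (t : ℂˣ) : Prop :=
  Function.Injective (P.alexanderOperator t) ∧ 0 < fkDet (P.alexanderOperator t)

end WirtingerPresentation

/-- The modulus `|t|` of a non-zero complex number, again as a non-zero complex number. -/
def absUnit (t : ℂˣ) : ℂˣ :=
  Units.mk0 ((‖(t : ℂ)‖ : ℝ) : ℂ) (Complex.ofReal_ne_zero.2 (norm_ne_zero_iff.2 t.ne_zero))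

end Alexander

/-! ### Knots -/

/-- The unit sphere `S³` in `ℝ⁴`. -/
abbrev S3 : Type := Metric.sphere (0 : EuclideanSpace ℝ (Fin 4)) 1

/-- A (tame) knot: the core of an open solid torus embedded in `S³`. Smooth and piecewise linear
knots are of this kind. -/
structure Knot where
  /-- The points of the knot. -/
  carrier : Set S3
  tame : ∃ h : Circle × ℂ → S3, Topology.IsOpenEmbedding h ∧
    h '' {p | p.2 = 0} = carrier

/-- `V` is an open tubular neighbourhood of the knot `K`: the open unit disc bundle in an open
solid torus `S¹ × ℂ` embedded in `S³` with core `K`. -/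
def Knot.IsTubularNeighbourhood (K : Knot) (V : Set S3) : Prop :=
  ∃ h : Circle × ℂ → S3, Topology.IsOpenEmbedding h ∧
    h '' {p | p.2 = 0} = K.carrier ∧ h '' {p | ‖p.2‖ < 1} = V

end L2Alexander

end

/-!
Write `t = θ |t|` with `θ` on the unit circle. Multiplying a function on `Γ` pointwise by the
unitary character `g ↦ θ ^ φ(g)` is a unitary operator `U` of `ℓ²(Γ)` (`characterTwist`). Because
the character is multiplicative, `U` intertwines right multiplication by `ψ_{|t|}(a)` with right
multiplication by `ψ_t(a)` (`rightMul_psi_characterTwist`), so that, applied in each coordinate, it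
conjugates `A_{|t|}` into `A_t` (`alexanderOperator_twist`).

The spectral projections of `f* f` are conjugated along with `f`. In general a unitary need not
preserve the von Neumann trace, which only tests an operator against the vectors with `e ∈ Γ` in
one coordinate; but the character takes the value `1` at `e`, so `U` fixes these vectors. Hence the
spectral density functions of `A_t` and `A_{|t|}` coincide (`spectralDensity_eq_of_intertwine`), and
with them the Fuglede–Kadison determinants. Injectivity is clearly invariant under conjugation.
-/

namespace L2Alexander

/-! ### Unitary invariance of the spectral density -/

section Conjugation

variable {H : Type*} [NormedAddCommGroup H] [InnerProductSpace ℂ H] [CompleteSpace H]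

lemma spectralSubspace_conjStarAlgEquiv (U : H ≃ₗᵢ[ℂ] H) {T : H →L[ℂ] H} (hT : IsSelfAdjoint T)
    (a : ℝ) :
    spectralSubspace (U.conjStarAlgEquiv T) a
      = (spectralSubspace T a).map U.toLinearEquiv.toLinearMap := by
  have hcont : Continuous U.conjStarAlgEquiv := by
    have h : ⇑U.conjStarAlgEquiv = fun S : H →L[ℂ] H =>
        (U : H →L[ℂ] H) ∘L S ∘L (U.symm : H →L[ℂ] H) := rfl
    rw [h]
    fun_prop
  have key : U.conjStarAlgEquiv (cfc (fun x : ℝ => max (x - a) 0) T)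
      = cfc (fun x : ℝ => max (x - a) 0) (U.conjStarAlgEquiv T) :=
    StarAlgHomClass.map_cfc (S := ℂ) U.conjStarAlgEquiv _ T (by fun_prop) hcont hT
      (hT.map U.conjStarAlgEquiv)
  ext x
  rw [spectralSubspace, ← key, Submodule.mem_map]
  constructor
  · intro hx
    refine ⟨U.symm x, ?_, U.apply_symm_apply x⟩
    exact U.injective (hx.trans (map_zero U).symm)
  · rintro ⟨y, hy, rfl⟩
    change U (cfc (fun x : ℝ => max (x - a) 0) T (U.symm (U y))) = 0
    rw [U.symm_apply_apply]
    exact (congrArg U hy).trans (map_zero U)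

lemma adjoint_comp_self_eq_conjStarAlgEquiv {H' : Type*} [NormedAddCommGroup H']
    [InnerProductSpace ℂ H'] [CompleteSpace H'] (U : H ≃ₗᵢ[ℂ] H) (W : H' ≃ₗᵢ[ℂ] H')
    {f f' : H →L[ℂ] H'} (h : ∀ x, f' (U x) = W (f x)) :
    f'.adjoint ∘L f' = U.conjStarAlgEquiv (f.adjoint ∘L f) := by
  ext1 x
  refine ext_inner_right ℂ fun y => ?_
  obtain ⟨x, rfl⟩ := U.surjective x
  obtain ⟨y, rfl⟩ := U.surjective y
  simp [ContinuousLinearMap.adjoint_inner_left, h]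

end Conjugation

section Density

variable {G : Type*} [Group G]

/-- The von Neumann dimension depends only on the norms of the projections of the vectors
`unitVec G i`; it is therefore invariant under every unitary that fixes these vectors, even one
which is not equivariant. -/
lemma vnDim_map {n : ℕ} (U : L2n G n ≃ₗᵢ[ℂ] L2n G n)
    (hU : ∀ i, U (unitVec G i) = unitVec G i) (S : Submodule ℂ (L2n G n))
    [S.HasOrthogonalProjection]
    [(S.map U.toLinearEquiv.toLinearMap).HasOrthogonalProjection] :
    vnDim (S.map U.toLinearEquiv.toLinearMap) = vnDim S := by
  rw [vnDim_eq, vnDim_eq]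
  refine Finset.sum_congr rfl fun i _ => ?_
  have h : (S.map U.toLinearEquiv.toLinearMap).starProjection (unitVec G i)
      = U (S.starProjection (U.symm (unitVec G i))) :=
    Submodule.starProjection_map_apply U S (unitVec G i)
  rw [h, U.norm_map, U.symm_apply_eq.2 (hU i).symm]

lemma spectralDensity_eq_of_intertwine {m n : ℕ} (U : L2n G m ≃ₗᵢ[ℂ] L2n G m)
    (W : L2n G n ≃ₗᵢ[ℂ] L2n G n) (hU : ∀ i, U (unitVec G i) = unitVec G i)
    {f f' : L2n G m →L[ℂ] L2n G n} (h : ∀ x, f' (U x) = W (f x)) :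
    spectralDensity f' = spectralDensity f := by
  funext l
  unfold spectralDensity
  split_ifs
  · have hS : spectralSubspace (f'.adjoint ∘L f') (l ^ 2)
        = (spectralSubspace (f.adjoint ∘L f) (l ^ 2)).map U.toLinearEquiv.toLinearMap := by
      rw [adjoint_comp_self_eq_conjStarAlgEquiv U W h,
        spectralSubspace_conjStarAlgEquiv U (isSelfAdjoint_adjoint_comp f)]
    simp only [hS]
    exact vnDim_map U hU _
  · rfl

lemma fkDet_eq_of_spectralDensity_eq {m n : ℕ} {f f' : L2n G m →L[ℂ] L2n G n}
    (h : spectralDensity f' = spectralDensity f) : fkDet f' = fkDet f := by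
  have hS : spectralStieltjes f' = spectralStieltjes f :=
    StieltjesFunction.ext fun l => congrFun h l
  rw [fkDet, fkDet, spectralMeasure, spectralMeasure, hS]

end Density

/-! ### Twisting by a unitary character -/

section Twist

variable {G : Type*} [Group G]

lemma memℓp_character_mul (χ : G →* Circle) (x : L2 G) :
    Memℓp (fun g : G => (χ g : ℂ) * x g) 2 :=
  (lp.memℓp x).mono' fun g => by simp [Circle.norm_coe]

/-- The unitary operator of `ℓ²(G)` that multiplies a function pointwise by the unitary character
`χ`. -/
noncomputable def characterTwist (χ : G →* Circle) : L2 G ≃ₗᵢ[ℂ] L2 G where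
  toFun x := ⟨fun g => (χ g : ℂ) * x g, memℓp_character_mul χ x⟩
  invFun x := ⟨fun g => (χ⁻¹ g : ℂ) * x g, memℓp_character_mul χ⁻¹ x⟩
  map_add' x y := by ext g; exact mul_add _ _ _
  map_smul' c x := by ext g; exact mul_left_comm _ _ _
  left_inv x := by ext g; simp
  right_inv x := by ext g; simp
  norm_map' x := by
    have h2 : 0 < (2 : ℝ≥0∞).toReal := by norm_num
    rw [lp.norm_eq_tsum_rpow h2, lp.norm_eq_tsum_rpow h2]
    simp [Circle.norm_coe]

lemma characterTwist_apply (χ : G →* Circle) (x : L2 G) (g : G) :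
    characterTwist χ x g = χ g * x g := rfl

/-- The coordinatewise twist fixes `unitVec G i`, since a character is `1` at the unit of `G`. -/
lemma piLpCongrRight_characterTwist_unitVec (χ : G →* Circle) {n : ℕ} (i : Fin n) :
    LinearIsometryEquiv.piLpCongrRight 2 (fun _ : Fin n => characterTwist χ) (unitVec G i)
      = unitVec G i := by
  ext j g
  change (χ g : ℂ) * unitVec G i j g = unitVec G i j g
  rcases eq_or_ne g 1 with rfl | hg
  · simp
  · have : unitVec G i j g = 0 := by
      rcases eq_or_ne j i with rfl | hj
      · simp [unitVec, hg]
      · simp [unitVec, hj]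
    rw [this, mul_zero]

lemma rightMulIsometry_characterTwist (χ : G →* Circle) (g : G) (x : L2 G) :
    (χ g : ℂ) • rightMulIsometry g (characterTwist χ x)
      = characterTwist χ (rightMulIsometry g x) := by
  ext h
  change (χ g : ℂ) * ((χ (h * g⁻¹) : ℂ) * x (h * g⁻¹)) = (χ h : ℂ) * x (h * g⁻¹)
  rw [← mul_assoc, ← Circle.coe_mul, ← map_mul, mul_comm]
  have : χ (g * (h * g⁻¹)) = χ h := by simp
  rw [this, mul_comm]

lemma rightMul_zero : rightMul (0 : MonoidAlgebra ℂ G) = 0 := by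
  simp [rightMul]

lemma rightMul_add (a b : MonoidAlgebra ℂ G) : rightMul (a + b) = rightMul a + rightMul b := by
  simp only [rightMul, MonoidAlgebra.coeff_add]
  exact Finsupp.sum_add_index' (fun _ => zero_smul _ _) (fun _ _ _ => add_smul _ _ _)

lemma rightMul_single (g : G) (c : ℂ) :
    rightMul (MonoidAlgebra.single g c) = c • (rightMulIsometry g).toContinuousLinearMap := by
  simp [rightMul]

lemma rightMulMatrix_apply {m n : ℕ} (A : Matrix (Fin m) (Fin n) (MonoidAlgebra ℂ G))
    (x : L2n G m) (j : Fin n) : rightMulMatrix A x j = ∑ i, rightMul (A i j) (x i) := by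
  simp [rightMulMatrix]

end Twist

/-! ### The Alexander operators at `t` and `|t|` -/

namespace WirtingerPresentation

variable {G : Type*} [Group G] (P : WirtingerPresentation G)

/-- The unitary character `g ↦ θ ^ φ(g)`. -/
noncomputable def phiCharacter (θ : Circle) : G →* Circle := (zpowersHom Circle θ).comp P.phi

lemma rightMul_psi_characterTwist (θ : Circle) {s t : ℂˣ} (hst : (t : ℂ) = θ * s)
    (a : MonoidAlgebra ℂ G) (x : L2 G) :
    rightMul (P.psi t a) (characterTwist (P.phiCharacter θ) x)
      = characterTwist (P.phiCharacter θ) (rightMul (P.psi s a) x) := by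
  induction a using MonoidAlgebra.induction_linear with
  | zero => simp [rightMul_zero]
  | add a b ha hb => simp [rightMul_add, ha, hb]
  | single g c =>
    have hθ : ((P.phiCharacter θ g : Circle) : ℂ) = (θ : ℂ) ^ (Multiplicative.toAdd (P.phi g)) := by
      simp [phiCharacter, zpowersHom_apply]
    have hc : c * (t : ℂ) ^ (Multiplicative.toAdd (P.phi g))
        = c * (s : ℂ) ^ (Multiplicative.toAdd (P.phi g)) * (P.phiCharacter θ g : Circle) := by
      rw [hst, mul_zpow, hθ]
      ring
    rw [psi_single, psi_single, rightMul_single, rightMul_single, hc, mul_smul]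
    simp only [smul_apply, map_smul]
    exact congrArg _ (rightMulIsometry_characterTwist (P.phiCharacter θ) g x)

lemma alexanderOperator_twist (θ : Circle) {s t : ℂˣ} (hst : (t : ℂ) = θ * s) (x : L2n G P.n) :
    P.alexanderOperator t
        (LinearIsometryEquiv.piLpCongrRight 2 (fun _ => characterTwist (P.phiCharacter θ)) x)
      = LinearIsometryEquiv.piLpCongrRight 2 (fun _ => characterTwist (P.phiCharacter θ))
        (P.alexanderOperator s x) := by
  refine PiLp.ext fun j => ?_
  simp [alexanderOperator, rightMulMatrix_apply, P.rightMul_psi_characterTwist θ hst]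

/-- Parameters that differ by a factor on the unit circle give the same invariant. -/
lemma alexanderInvariant_eq_of_circle_mul (θ : Circle) {s t : ℂˣ} (hst : (t : ℂ) = θ * s) :
    P.alexanderInvariant t = P.alexanderInvariant s :=
  fkDet_eq_of_spectralDensity_eq <| spectralDensity_eq_of_intertwine _ _
    (piLpCongrRight_characterTwist_unitVec (P.phiCharacter θ)) (P.alexanderOperator_twist θ hst)

lemma injective_alexanderOperator_iff_of_circle_mul (θ : Circle) {s t : ℂˣ}
    (hst : (t : ℂ) = θ * s) :
    Function.Injective (P.alexanderOperator t) ↔ Function.Injective (P.alexanderOperator s) := by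
  set U : L2n G P.n ≃ₗᵢ[ℂ] L2n G P.n :=
    LinearIsometryEquiv.piLpCongrRight 2 (fun _ => characterTwist (P.phiCharacter θ))
  have h : P.alexanderOperator t ∘ U = U ∘ P.alexanderOperator s :=
    funext (P.alexanderOperator_twist θ hst)
  rw [← Function.Injective.of_comp_iff' _ U.bijective, h,
    Function.Injective.of_comp_iff U.injective]

end WirtingerPresentation

lemma exists_circle_mul_absUnit (t : ℂˣ) : ∃ θ : Circle, (t : ℂ) = θ * absUnit t := by
  refine ⟨Circle.exp (Complex.arg t), ?_⟩
  rw [Circle.coe_exp, mul_comm]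
  exact (Complex.norm_mul_exp_arg_mul_I t).symm

end L2Alexander

theorem mainTheorem6 (K : L2Alexander.Knot) (V : Set L2Alexander.S3)
    (hV : K.IsTubularNeighbourhood V) (x : (Vᶜ : Set L2Alexander.S3))
    (P : L2Alexander.WirtingerPresentation (FundamentalGroup (Vᶜ : Set L2Alexander.S3) x))
    (t : ℂˣ) :
    (P.Admissible t ↔ P.Admissible (L2Alexander.absUnit t)) ∧
      P.alexanderInvariant t = P.alexanderInvariant (L2Alexander.absUnit t) := by
  obtain ⟨θ, hθ⟩ := L2Alexander.exists_circle_mul_absUnit t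
  have hdet := P.alexanderInvariant_eq_of_circle_mul θ hθ
  refine ⟨and_congr (P.injective_alexanderOperator_iff_of_circle_mul θ hθ) ?_, hdet⟩
  exact iff_of_eq (congrArg (0 < ·) hdet)
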